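/- Let $\mathit{Atm}_0$ be a countable (finite or countably infinite) set of atomic propositions and $\mathit{Val}$ a finite set of output values, both given with a primitive recursive coding of their elements by natural numbers. The formulas of the dynamic language $\mathcal{L}^{dyn}$ are given by $$\varphi ::= p \mid \mathsf{t}(x) \mid \neg\varphi \mid \varphi_1\wedge\varphi_2 \mid \Box_{\mathtt I}\varphi \mid \Box_{\mathtt F}\varphi \mid [\varphi]\psi, \qquad p\in \mathit{Atm}_0,\ x\in \mathit{Val}.$$ A multi-classifier model (MCM) is a pair $\Gamma=(S,\Phi)$ with $S\subseteq 2^{\mathit{Atm}_0}$ and $\Phi\subseteq \mathit{Val}^S$. For $s\in S$ and $f\in\Phi$, satisfaction is defined by: - $(\Gamma,s,f)\models p$ iff $p\in s$; - $(\Gamma,s,f)\models \mathsf{t}(x)$ iff $f(s)=x$; - the usual Boolean clauses for $\neg$ and $\wedge$; - $(\Gamma,s,f)\models\Box_{\mathtt I}\varphi$ iff $(\Gamma,s',f)\models\varphi$ for all $s'\in S$; - $(\Gamma,s,f)\models\Box_{\mathtt F}\varphi$ iff $(\Gamma,s,f')\models\varphi$ for all $f'\in\Phi$; - $(\Gamma,s,f)\models[\varphi]\psi$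 iff $(\Gamma,s,f)\models\Box_{\mathtt I}\varphi$ implies $(\Gamma^{\varphi},s,f)\models\psi$, where $\Gamma^{\varphi}=(S,\{f'\in\Phi : (\Gamma,s',f')\models\varphi \text{ for all } s'\in S\})$. A formula $\varphi$ is satisfiable relative to the class of MCMs if $(\Gamma,s,f)\models\varphi$ for some MCM $\Gamma=(S,\Phi)$, $s\in S$ and $f\in\Phi$. **Theorem.** Satisfiability of $\mathcal{L}^{dyn}$-formulas relative to the class of MCMs is decidable: there is an algorithm which, given a formula $\varphi$ of $\mathcal{L}^{dyn}$ (as a string of symbols), decides whether $\varphi$ is satisfiable relative to the class of MCMs. -/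

import Mathlib

/-- Formulas of the dynamic language over a set `A` of input atoms and a set `V` of output
values: `p`, `t(x)`, `¬ φ`, `φ ∧ ψ`, `□_I φ`, `□_F φ` and `[φ] ψ`. -/
inductive DynFormula (A : Type*) (V : Type*) where
  | atom (p : A) : DynFormula A V
  | dec (x : V) : DynFormula A V
  | neg (φ : DynFormula A V) : DynFormula A V
  | and (φ ψ : DynFormula A V) : DynFormula A V
  | boxI (φ : DynFormula A V) : DynFormula A V
  | boxF (φ : DynFormula A V) : DynFormula A V
  | upd (φ ψ : DynFormula A V) : DynFormula A V

/-- A multi-classifier model `(S, Φ)`: a set `S` of input instances, each of which is a subset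
of `A`, and a set `Φ` of functions from `S` to `V`. -/
structure MCM (A : Type*) (V : Type*) where
  S : Set (Set A)
  Φ : Set (S → V)

/-- The model obtained from `Γ` by keeping all input instances and exactly those classifiers `f'`
for which `P s' f'` holds at every input instance `s'`. -/
def MCM.restrict {A V : Type*} (Γ : MCM A V) (P : Γ.S → (Γ.S → V) → Prop) : MCM A V where
  S := Γ.S
  Φ := {f' | f' ∈ Γ.Φ ∧ ∀ s' : Γ.S, P s' f'}

/-- `φ.Holds Γ s f` is the satisfaction relation `(Γ, s, f) ⊨ φ`. -/
def DynFormula.Holds {A V : Type*} :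
    DynFormula A V → (Γ : MCM A V) → Γ.S → (Γ.S → V) → Prop
  | .atom p, _, s, _ => p ∈ s.1
  | .dec x, _, s, f => f s = x
  | .neg φ, Γ, s, f => ¬ φ.Holds Γ s f
  | .and φ ψ, Γ, s, f => φ.Holds Γ s f ∧ ψ.Holds Γ s f
  | .boxI φ, Γ, _, f => ∀ s' : Γ.S, φ.Holds Γ s' f
  | .boxF φ, Γ, s, _ => ∀ f' ∈ Γ.Φ, φ.Holds Γ s f'
  | .upd φ ψ, Γ, s, f =>
      (∀ s' : Γ.S, φ.Holds Γ s' f) → ψ.Holds (Γ.restrict (φ.Holds Γ)) s f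

/-- `φ` is true at some pointed multi-classifier model `(Γ, s, f)`, `s ∈ S`, `f ∈ Φ`. -/
def DynFormula.Satisfiable {A V : Type*} (φ : DynFormula A V) : Prop :=
  ∃ (Γ : MCM A V) (s : Γ.S), ∃ f ∈ Γ.Φ, φ.Holds Γ s f

/-! Coding of formulas.  A formula is presented to an algorithm as the string of symbols that
writes it in prefix (Polish) notation. -/

/-- The alphabet: atoms, output values and the five connectives, numbered
`0 = ¬`, `1 = ∧`, `2 = □_I`, `3 = □_F`, `4 = [·]·`. -/
abbrev DynSymbol (A : Type*) (V : Type*) := A ⊕ (V ⊕ Fin 5)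

/-- The formula in prefix notation. -/
def DynFormula.word {A V : Type*} : DynFormula A V → List (DynSymbol A V)
  | .atom p => [.inl p]
  | .dec x => [.inr (.inl x)]
  | .neg φ => .inr (.inr 0) :: φ.word
  | .and φ ψ => .inr (.inr 1) :: (φ.word ++ ψ.word)
  | .boxI φ => .inr (.inr 2) :: φ.word
  | .boxF φ => .inr (.inr 3) :: φ.word
  | .upd φ ψ => .inr (.inr 4) :: (φ.word ++ ψ.word)

/-- Number of arguments of a symbol. -/
def DynSymbol.arity {A V : Type*} : DynSymbol A V → ℕ
  | .inl _ => 0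
  | .inr (.inl _) => 0
  | .inr (.inr c) => ![1, 2, 1, 1, 2] c

/-- Effect of reading one symbol, from right to left, on the number of complete formulas read. -/
def DynSymbol.step {A V : Type*} (c : DynSymbol A V) (o : Option ℕ) : Option ℕ :=
  o.bind fun n => if DynSymbol.arity c ≤ n then some (n + 1 - DynSymbol.arity c) else none

/-- The number of formulas of which the string is the concatenation, if there is one. -/
def dynCount {A V : Type*} (w : List (DynSymbol A V)) : Option ℕ :=
  w.foldr DynSymbol.step (some 0)

theorem DynFormula.foldr_word {A V : Type*} (φ : DynFormula A V) (n : ℕ) :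
    φ.word.foldr DynSymbol.step (some n) = some (n + 1) := by
  induction φ generalizing n with
  | atom p => simp [word, DynSymbol.step, DynSymbol.arity]
  | dec x => simp [word, DynSymbol.step, DynSymbol.arity]
  | neg φ ih => simp [word, ih, DynSymbol.step, DynSymbol.arity]
  | and φ ψ ih₁ ih₂ => simp [word, ih₁, ih₂, DynSymbol.step, DynSymbol.arity]
  | boxI φ ih => simp [word, ih, DynSymbol.step, DynSymbol.arity]
  | boxF φ ih => simp [word, ih, DynSymbol.step, DynSymbol.arity]
  | upd φ ψ ih₁ ih₂ => simp [word, ih₁, ih₂, DynSymbol.step, DynSymbol.arity]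

theorem DynFormula.word_append_inj {A V : Type*} (φ ψ : DynFormula A V)
    (u v : List (DynSymbol A V)) (h : φ.word ++ u = ψ.word ++ v) : φ = ψ ∧ u = v := by
  induction φ generalizing ψ u v with
  | atom p => cases ψ <;> simp_all [word]
  | dec x => cases ψ <;> simp_all [word]
  | neg φ ih =>
    cases ψ <;> simp [word] at h
    obtain ⟨rfl, rfl⟩ := ih _ _ _ h
    exact ⟨rfl, rfl⟩
  | and φ φ' ih₁ ih₂ =>
    cases ψ <;> simp [word] at h
    obtain ⟨rfl, h'⟩ := ih₁ _ _ _ h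
    obtain ⟨rfl, rfl⟩ := ih₂ _ _ _ h'
    exact ⟨rfl, rfl⟩
  | boxI φ ih =>
    cases ψ <;> simp [word] at h
    obtain ⟨rfl, rfl⟩ := ih _ _ _ h
    exact ⟨rfl, rfl⟩
  | boxF φ ih =>
    cases ψ <;> simp [word] at h
    obtain ⟨rfl, rfl⟩ := ih _ _ _ h
    exact ⟨rfl, rfl⟩
  | upd φ φ' ih₁ ih₂ =>
    cases ψ <;> simp [word] at h
    obtain ⟨rfl, h'⟩ := ih₁ _ _ _ h
    obtain ⟨rfl, rfl⟩ := ih₂ _ _ _ h'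
    exact ⟨rfl, rfl⟩

/-- Unique readability. -/
theorem DynFormula.word_injective {A V : Type*} :
    Function.Injective (DynFormula.word : DynFormula A V → List (DynSymbol A V)) :=
  fun φ ψ h => (word_append_inj φ ψ [] [] (by simpa using h)).1

theorem dynCount_parse {A V : Type*} (w : List (DynSymbol A V)) (n : ℕ)
    (h : dynCount w = some n) :
    ∃ l : List (DynFormula A V), l.length = n ∧ l.flatMap DynFormula.word = w := by
  induction w generalizing n with
  | nil => exact ⟨[], by simpa [dynCount] using h, rfl⟩
  | cons c w ih =>
    have h' : DynSymbol.step c (dynCount w) = some n := h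
    cases hm : dynCount w with
    | none => simp [hm, DynSymbol.step] at h'
    | some m =>
      obtain ⟨l, hl, rfl⟩ := ih m hm
      rw [hm] at h'
      simp only [DynSymbol.step, Option.bind_some, Option.ite_none_right_eq_some,
        Option.some.injEq] at h'
      obtain ⟨h₁, h₂⟩ := h'
      rcases c with p | x | c
      · exact ⟨.atom p :: l, by simp [DynSymbol.arity] at h₂; simp; omega,
          by simp [DynFormula.word]⟩
      · exact ⟨.dec x :: l, by simp [DynSymbol.arity] at h₂; simp; omega,
          by simp [DynFormula.word]⟩
      · fin_cases c <;> simp [DynSymbol.arity] at h₁ h₂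
        · obtain _ | ⟨φ, l⟩ := l
          · simp at hl; omega
          · exact ⟨.neg φ :: l, by simp at hl ⊢; omega, by simp [DynFormula.word]⟩
        · obtain _ | ⟨φ, _ | ⟨ψ, l⟩⟩ := l
          · simp at hl; omega
          · simp at hl; omega
          · exact ⟨.and φ ψ :: l, by simp at hl ⊢; omega, by simp [DynFormula.word]⟩
        · obtain _ | ⟨φ, l⟩ := l
          · simp at hl; omega
          · exact ⟨.boxI φ :: l, by simp at hl ⊢; omega, by simp [DynFormula.word]⟩
        · obtain _ | ⟨φ, l⟩ := l
          · simp at hl; omega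
          · exact ⟨.boxF φ :: l, by simp at hl ⊢; omega, by simp [DynFormula.word]⟩
        · obtain _ | ⟨φ, _ | ⟨ψ, l⟩⟩ := l
          · simp at hl; omega
          · simp at hl; omega
          · exact ⟨.upd φ ψ :: l, by simp at hl ⊢; omega, by simp [DynFormula.word]⟩

/-- Formulas correspond to the strings that consist of exactly one complete formula. -/
noncomputable def DynFormula.equivWord (A V : Type*) :
    DynFormula A V ≃ {w : List (DynSymbol A V) // dynCount w = some 1} :=
  Equiv.ofBijective (fun φ => ⟨φ.word, φ.foldr_word 0⟩) <| by
    constructor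
    · intro φ ψ h
      exact DynFormula.word_injective (congrArg Subtype.val h)
    · rintro ⟨w, hw⟩
      obtain ⟨l, hl, rfl⟩ := dynCount_parse w 1 hw
      obtain ⟨φ, rfl⟩ := List.length_eq_one_iff.1 hl
      exact ⟨φ, by simp⟩

theorem DynSymbol.primrec_arity {A V : Type*} [Primcodable A] [Primcodable V] :
    Primrec (DynSymbol.arity : DynSymbol A V → ℕ) := by
  have h : Primrec (fun c : Fin 5 => ![1, 2, 1, 1, 2] c : Fin 5 → ℕ) := Primrec.dom_finite _
  have h₁ : Primrec (fun c : V ⊕ Fin 5 =>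
      (Sum.casesOn c (fun _ => 0) (fun d => ![1, 2, 1, 1, 2] d) : ℕ)) :=
    Primrec.sumCasesOn (f := fun c : V ⊕ Fin 5 => c) Primrec.id (Primrec.const 0).to₂
      (h.comp Primrec.snd).to₂
  refine (Primrec.sumCasesOn (f := fun c : DynSymbol A V => c) Primrec.id (Primrec.const 0).to₂
    (h₁.comp Primrec.snd).to₂).of_eq ?_
  rintro (p | x | c) <;> rfl

theorem primrec_dynCount {A V : Type*} [Primcodable A] [Primcodable V] :
    Primrec (dynCount : List (DynSymbol A V) → Option ℕ) := by
  have ha : Primrec (fun q : (List (DynSymbol A V) × DynSymbol A V × Option ℕ) × ℕ =>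
      DynSymbol.arity q.1.2.1) :=
    DynSymbol.primrec_arity.comp (Primrec.fst.comp (Primrec.snd.comp Primrec.fst))
  have hs : Primrec₂ (fun (_ : List (DynSymbol A V)) (q : DynSymbol A V × Option ℕ) =>
      DynSymbol.step q.1 q.2) := by
    refine Primrec.option_bind (Primrec.snd.comp Primrec.snd) ?_
    refine Primrec.ite (Primrec.nat_le.comp ha Primrec.snd) ?_ (Primrec.const none)
    exact Primrec.option_some.comp
      (Primrec.nat_sub.comp (Primrec.succ.comp Primrec.snd) ha)
  exact Primrec.list_foldr Primrec.id (Primrec.const (some 0)) hs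

/-- A formula is coded by its string in prefix notation. -/
noncomputable instance DynFormula.instPrimcodable {A V : Type*} [Primcodable A] [Primcodable V] :
    Primcodable (DynFormula A V) :=
  haveI : Primcodable {w : List (DynSymbol A V) // dynCount w = some 1} :=
    Primcodable.subtype (Primrec.eq.comp primrec_dynCount (Primrec.const (some 1)))
  Primcodable.ofEquiv _ (DynFormula.equivWord A V)

theorem DynFormula.encode_eq {A V : Type*} [Primcodable A] [Primcodable V]
    (φ : DynFormula A V) : Encodable.encode φ = Encodable.encode φ.word := rfl

/-! An update removes classifiers but never instances, and a classifier survives exactly when the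
announced formula holds at all its instances. The survivors are therefore defined by a formula `□_I
θ`, and updates can be eliminated by relativizing `□_F` to it (`DynFormula.toStat`). What remains is
a two-sorted static language over a product of instances and classifiers.

That language has the finite model property with a computable bound
(`StatFormula.exists_finite_model`). Points are typed by the subformulas true at them, rows and
columns by the set of types they contain, and a finite product is sampled so that each line still
shows exactly the types it should (`exists_regular_sampling`).

If there are infinitely many atoms, fresh ones separate the instances of a finite frame, so finite
frames and multi-classifier models satisfy the same formulas; all tables up to the bound are
searched. If there are finitely many atoms, instances cannot be separated at will, but there are
only finitely many models, and each formula denotes an element of a fixed finite set that is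
computed compositionally. -/

/-! ### Satisfaction relative to a set of remaining classifiers. -/

/-- Satisfaction on a frame with instances `S` and classifiers `F`, relative to the set `P` of
classifiers that are still present. -/
def DynFormula.RelHolds {A V S F : Type*} (val : S → A → Prop) (out : S → F → V → Prop) :
    DynFormula A V → Set F → S → F → Prop
  | .atom p, _, s, _ => val s p
  | .dec x, _, s, f => out s f x
  | .neg φ, P, s, f => ¬ φ.RelHolds val out P s f
  | .and φ ψ, P, s, f => φ.RelHolds val out P s f ∧ ψ.RelHolds val out P s f
  | .boxI φ, P, _, f => ∀ s', φ.RelHolds val out P s' f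
  | .boxF φ, P, s, _ => ∀ f' ∈ P, φ.RelHolds val out P s f'
  | .upd φ ψ, P, s, f =>
      (∀ s', φ.RelHolds val out P s' f) →
        ψ.RelHolds val out {f' | f' ∈ P ∧ ∀ s', φ.RelHolds val out P s' f'} s f

/-- Updates leave `S` alone, so the type of classifiers stays fixed through all nested updates and
only the subset `Φ` shrinks. -/
theorem DynFormula.holds_iff_relHolds {A V : Type*} (φ : DynFormula A V) (S : Set (Set A))
    (Φ : Set (S → V)) (s : S) (f : S → V) :
    φ.Holds ⟨S, Φ⟩ s f ↔
      φ.RelHolds (fun (s : S) p => p ∈ s.1) (fun s f x => f s = x) Φ s f := by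
  induction φ generalizing Φ s f with
  | atom p => rfl
  | dec x => rfl
  | neg φ ih => simp only [Holds, RelHolds, ih]
  | and φ ψ ih₁ ih₂ => simp only [Holds, RelHolds, ih₁, ih₂]
  | boxI φ ih => simp only [Holds, RelHolds, ih]
  | boxF φ ih => simp only [Holds, RelHolds, ih]
  | upd φ ψ ih₁ ih₂ => simp only [Holds, RelHolds, MCM.restrict, ih₁, ih₂]

/-- Relative satisfaction is reflected and preserved by maps of frames that are surjective on
instances and onto the classifiers still present. -/
theorem DynFormula.relHolds_comap {A V S F S' F' : Type*} {val : S → A → Prop}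
    {out : S → F → V → Prop} {val' : S' → A → Prop} {out' : S' → F' → V → Prop}
    (φ : DynFormula A V) {a : S → S'} {g : F → F'} (ha : Function.Surjective a)
    (hval : ∀ s p, .inl p ∈ φ.word → (val s p ↔ val' (a s) p))
    (hout : ∀ s f x, out s f x ↔ out' (a s) (g f) x) {P : Set F} {P' : Set F'}
    (hP : ∀ f, f ∈ P ↔ g f ∈ P') (hr : P' ⊆ Set.range g) (s : S) (f : F) :
    φ.RelHolds val out P s f ↔ φ.RelHolds val' out' P' (a s) (g f) := by
  induction φ generalizing P P' s f with
  | atom p => exact hval s p (by simp [word])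
  | dec x => exact hout s f x
  | neg φ ih =>
    simp only [RelHolds, ih (fun s p h => hval s p (by simp [word, h])) hP hr]
  | and φ ψ ih₁ ih₂ =>
    simp only [RelHolds, ih₁ (fun s p h => hval s p (by simp [word, h])) hP hr,
      ih₂ (fun s p h => hval s p (by simp [word, h])) hP hr]
  | boxI φ ih =>
    simp only [RelHolds, ih (fun s p h => hval s p (by simp [word, h])) hP hr, ha.forall]
  | boxF φ ih =>
    simp only [RelHolds, ih (fun s p h => hval s p (by simp [word, h])) hP hr]
    constructor
    · intro h f' hf'
      obtain ⟨f', rfl⟩ := hr hf'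
      exact h f' ((hP f').2 hf')
    · exact fun h f' hf' => h _ ((hP f').1 hf')
  | upd φ ψ ih₁ ih₂ =>
    have h₁ := fun s f => ih₁ (fun s p h => hval s p (by simp [word, h])) hP hr s f
    simp only [RelHolds, h₁, ha.forall]
    -- Because `a` is onto, the announcement is satisfied at all instances on both sides or on
    -- neither; hence the surviving classifiers again correspond under `g`, and the induction
    -- applies to the smaller sets.
    refine imp_congr_right fun _ => ih₂ (fun s p h => hval s p (by simp [word, h])) ?_ ?_ s f
    · intro f
      simp only [Set.mem_ofPred_eq, hP]
    · exact fun f' hf' => hr hf'.1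

/-! ### Elimination of updates. -/

/-- Formulas without update operators. -/
inductive StatFormula (A : Type*) (V : Type*) where
  | top : StatFormula A V
  | atom (p : A) : StatFormula A V
  | dec (x : V) : StatFormula A V
  | neg (φ : StatFormula A V) : StatFormula A V
  | and (φ ψ : StatFormula A V) : StatFormula A V
  | boxI (φ : StatFormula A V) : StatFormula A V
  | boxF (φ : StatFormula A V) : StatFormula A V

/-- Satisfaction of static formulas on a frame. -/
def StatFormula.Holds {A V S F : Type*} (val : S → A → Prop) (out : S → F → V → Prop) :
    StatFormula A V → S → F → Prop
  | .top, _, _ => True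
  | .atom p, s, _ => val s p
  | .dec x, s, f => out s f x
  | .neg φ, s, f => ¬ φ.Holds val out s f
  | .and φ ψ, s, f => φ.Holds val out s f ∧ ψ.Holds val out s f
  | .boxI φ, _, f => ∀ s', φ.Holds val out s' f
  | .boxF φ, s, _ => ∀ f', φ.Holds val out s f'

/-- The list of subformulas. -/
def StatFormula.subs {A V : Type*} : StatFormula A V → List (StatFormula A V)
  | .top => [.top]
  | .atom p => [.atom p]
  | .dec x => [.dec x]
  | .neg φ => .neg φ :: φ.subs
  | .and φ ψ => .and φ ψ :: (φ.subs ++ ψ.subs)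
  | .boxI φ => .boxI φ :: φ.subs
  | .boxF φ => .boxF φ :: φ.subs

theorem StatFormula.self_mem_subs {A V : Type*} (φ : StatFormula A V) : φ ∈ φ.subs := by
  cases φ <;> simp [subs]

theorem StatFormula.subs_subset {A V : Type*} {φ ψ : StatFormula A V} (h : φ ∈ ψ.subs) :
    φ.subs ⊆ ψ.subs := by
  induction ψ with
  | top => simp only [subs, List.mem_singleton] at h; subst h; simp
  | atom p => simp only [subs, List.mem_singleton] at h; subst h; simp
  | dec x => simp only [subs, List.mem_singleton] at h; subst h; simp
  | neg ψ ih | boxI ψ ih | boxF ψ ih =>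
    rcases List.mem_cons.1 h with rfl | h
    · simp
    · exact fun _ hx => List.mem_cons_of_mem _ (ih h hx)
  | and ψ₁ ψ₂ ih₁ ih₂ =>
    rcases List.mem_cons.1 h with rfl | h
    · simp
    · rcases List.mem_append.1 h with h | h
      · exact fun _ hx => List.mem_cons_of_mem _ (List.mem_append_left _ (ih₁ h hx))
      · exact fun _ hx => List.mem_cons_of_mem _ (List.mem_append_right _ (ih₂ h hx))

/-- Elimination of updates, relative to the classifiers that satisfy `θ` at all instances. -/
def DynFormula.toStat {A V : Type*} : DynFormula A V → StatFormula A V → StatFormula A V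
  | .atom p, _ => .atom p
  | .dec x, _ => .dec x
  | .neg φ, θ => .neg (φ.toStat θ)
  | .and φ ψ, θ => .and (φ.toStat θ) (ψ.toStat θ)
  | .boxI φ, θ => .boxI (φ.toStat θ)
  | .boxF φ, θ => .boxF (.neg (.and (.boxI θ) (.neg (φ.toStat θ))))
  | .upd φ ψ, θ =>
      .neg (.and (.boxI (φ.toStat θ)) (.neg (ψ.toStat (.and θ (φ.toStat θ)))))

/-- Successive updates accumulate in `θ` because `□_I` distributes over conjunction: satisfying `θ`
everywhere and then the announcement everywhere is satisfying their conjunction everywhere. -/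
theorem DynFormula.relHolds_iff_toStat {A V S F : Type*} (val : S → A → Prop)
    (out : S → F → V → Prop) (φ : DynFormula A V) (θ : StatFormula A V) (s : S) (f : F) :
    φ.RelHolds val out {f' | ∀ s', θ.Holds val out s' f'} s f ↔
      (φ.toStat θ).Holds val out s f := by
  induction φ generalizing θ s f with
  | atom p => rfl
  | dec x => rfl
  | neg φ ih => simp only [RelHolds, toStat, StatFormula.Holds, ih]
  | and φ ψ ih₁ ih₂ => simp only [RelHolds, toStat, StatFormula.Holds, ih₁, ih₂]
  | boxI φ ih => simp only [RelHolds, toStat, StatFormula.Holds, ih]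
  | boxF φ ih =>
    simp only [RelHolds, toStat, StatFormula.Holds, ih, Set.mem_ofPred_eq, not_and, not_not]
  | upd φ ψ ih₁ ih₂ =>
    have h : {f' | f' ∈ {f' | ∀ s', θ.Holds val out s' f'} ∧
        ∀ s', (φ.toStat θ).Holds val out s' f'} =
        {f' | ∀ s', (StatFormula.and θ (φ.toStat θ)).Holds val out s' f'} := by
      ext f'
      simp only [Set.mem_ofPred_eq, StatFormula.Holds, forall_and]
    simp only [RelHolds, toStat, ih₁, h, ih₂]
    simp only [StatFormula.Holds, not_and, not_not]

/-- Every symbol multiplies the size by at most 8. The point is that the bound depends on the length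
of the string alone, so that the size of the search is computable. -/
theorem DynFormula.length_subs_toStat_le {A V : Type*} (φ : DynFormula A V)
    (θ : StatFormula A V) :
    (φ.toStat θ).subs.length ≤ θ.subs.length * 8 ^ φ.word.length := by
  have pos (χ : StatFormula A V) : 1 ≤ χ.subs.length :=
    List.length_pos_of_mem χ.self_mem_subs
  have hle (a b : ℕ) : 8 ^ a ≤ 8 ^ (a + b) := Nat.pow_le_pow_right (by norm_num) (by omega)
  induction φ generalizing θ with
  | atom p => have := pos θ; simp [toStat, StatFormula.subs, word]; omega
  | dec x => have := pos θ; simp [toStat, StatFormula.subs, word]; omega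
  | neg φ ih =>
    have := ih θ
    have := pos (φ.toStat θ)
    simp only [toStat, StatFormula.subs, word, List.length_cons, pow_succ, ← mul_assoc] at *
    omega
  | and φ ψ ih₁ ih₂ =>
    have h₁ := ih₁ θ
    have h₂ := ih₂ θ
    have h₃ := Nat.mul_le_mul_left θ.subs.length (hle φ.word.length ψ.word.length)
    have h₄ := Nat.mul_le_mul_left θ.subs.length (hle ψ.word.length φ.word.length)
    have := pos (φ.toStat θ)
    rw [add_comm ψ.word.length] at h₄
    simp only [toStat, StatFormula.subs, word, List.length_cons, List.length_append, pow_succ, ← mul_assoc]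
    omega
  | boxI φ ih =>
    have := ih θ
    have := pos (φ.toStat θ)
    simp only [toStat, StatFormula.subs, word, List.length_cons, pow_succ, ← mul_assoc] at *
    omega
  | boxF φ ih =>
    have := ih θ
    have := pos (φ.toStat θ)
    have h₃ := Nat.mul_le_mul_left θ.subs.length (Nat.one_le_pow φ.word.length 8 (by norm_num))
    simp only [toStat, StatFormula.subs, word, List.length_cons, List.length_append, pow_succ, ← mul_assoc]
      at *
    omega
  | upd φ ψ ih₁ ih₂ =>
    have h₁ := ih₁ θ
    have h₂ := ih₂ (.and θ (φ.toStat θ))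
    have h₃ := Nat.mul_le_mul_left θ.subs.length (hle φ.word.length ψ.word.length)
    have h₄ := pos (φ.toStat θ)
    have h₅ := pos θ
    have h₆ : 1 ≤ 8 ^ φ.word.length := Nat.one_le_pow _ _ (by norm_num)
    have h₇ : 1 ≤ θ.subs.length * 8 ^ φ.word.length := Nat.mul_pos h₅ h₆
    have h₈ : θ.subs.length ≤ θ.subs.length * 8 ^ φ.word.length := Nat.le_mul_of_pos_right _ h₆
    simp only [toStat, StatFormula.subs, word, List.length_cons, List.length_append, pow_succ, ← mul_assoc]
      at *
    -- The worst case, which dictates the base 8: four new connectives, one copy of the translated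
    -- announcement, and a translation of `ψ` whose parameter is up to three times as large, 4 + 1 +
    -- 3.
    have h₉ : (θ.subs.length + (φ.toStat θ).subs.length + 1) * 8 ^ ψ.word.length ≤
        3 * (θ.subs.length * 8 ^ (φ.word.length + ψ.word.length)) := by
      rw [pow_add, ← mul_assoc, ← mul_assoc]
      exact Nat.mul_le_mul_right _ (by linarith)
    omega

/-! ### Finite model property of the static language. -/

/-- A bound on the size of models of formulas with `n` symbols. -/
def dynBound (n : ℕ) : ℕ := 2 ^ 2 ^ 8 ^ n * 2 ^ 8 ^ n

theorem exists_surjective_fin {α : Type*} [Finite α] [Nonempty α] {n : ℕ} (h : Nat.card α ≤ n) :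
    ∃ g : Fin n → α, Function.Surjective g := by
  have e : Fin (Nat.card α) ↪ Fin n := Fin.castLEEmb h
  let i : α → Fin n := fun x => e (Finite.equivFin α x)
  have hi : Function.Injective i := e.injective.comp (Finite.equivFin α).injective
  exact ⟨Function.invFun i, Function.invFun_surjective hi⟩

/-- A choice of points of a product whose rows, columns and points are typed, indexed by a finite
product, so that every type that occurs in a rectangle of kinds occurs on each line of it. -/
theorem exists_regular_sampling {S F T : Type*} (τ : S → F → Set T) (s₀ : S) (f₀ : F) :
    ∃ (X Y : Set (Set (Set T) × Set T)) (h : X → Y → S × F), X.Nonempty ∧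
      (∃ y : Y, Set.range (fun s => τ s f₀) = y.1.1) ∧
      (∀ x y, Set.range (τ (h x y).1) = x.1.1) ∧
      (∀ x y, Set.range (fun s => τ s (h x y).2) = y.1.1) ∧
      (∀ s (y : Y), ∀ f, Set.range (fun s => τ s f) = y.1.1 →
        ∃ x : X, τ (h x y).1 (h x y).2 = τ s f) ∧
      (∀ (x : X) s f, Set.range (τ s) = x.1.1 →
        ∃ y : Y, τ (h x y).1 (h x y).2 = τ s f) := by
  classical
  -- Each index carries a realized kind of line and an arbitrary mark in `Set T`. The marks of a row
  -- and a column add up, by symmetric difference, to the type requested at their crossing.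
  let X : Set (Set (Set T) × Set T) := {x | ∃ s, Set.range (τ s) = x.1}
  let Y : Set (Set (Set T) × Set T) := {y | ∃ f, Set.range (fun s => τ s f) = y.1}
  -- The request is granted if that type occurs somewhere in the rectangle of the two kinds;
  -- otherwise any point of the right kinds will do.
  have key (x : X) (y : Y) : ∃ q : S × F, Set.range (τ q.1) = x.1.1 ∧
      Set.range (fun s => τ s q.2) = y.1.1 ∧ ∀ s f, Set.range (τ s) = x.1.1 →
      Set.range (fun s => τ s f) = y.1.1 → τ s f = symmDiff x.1.2 y.1.2 →
      τ q.1 q.2 = symmDiff x.1.2 y.1.2 := by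
    by_cases hq : ∃ q : S × F, Set.range (τ q.1) = x.1.1 ∧
      Set.range (fun s => τ s q.2) = y.1.1 ∧ τ q.1 q.2 = symmDiff x.1.2 y.1.2
    · obtain ⟨q, h₁, h₂, h₃⟩ := hq
      exact ⟨q, h₁, h₂, fun _ _ _ _ _ => h₃⟩
    · obtain ⟨s, hs⟩ := x.2
      obtain ⟨f, hf⟩ := y.2
      exact ⟨(s, f), hs, hf, fun s f h₁ h₂ h₃ => (hq ⟨(s, f), h₁, h₂, h₃⟩).elim⟩
  choose h h₁ h₂ h₃ using key
  refine ⟨X, Y, h, ⟨(_, ∅), s₀, rfl⟩, ⟨⟨(_, ∅), f₀, rfl⟩, rfl⟩, h₁, h₂, ?_, ?_⟩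
  · intro s y f hf
    -- With one mark fixed, the other can be solved for so that the request is the given type; it is
    -- granted, since the type occurs at `(s, f)` itself.
    let x : X := ⟨(Set.range (τ s), symmDiff (τ s f) y.1.2), s, rfl⟩
    have hx : symmDiff x.1.2 y.1.2 = τ s f := symmDiff_symmDiff_cancel_right _ _
    exact ⟨x, (h₃ x y s f rfl hf hx.symm).trans hx⟩
  · intro x s f hs
    let y : Y := ⟨(Set.range (fun s => τ s f), symmDiff x.1.2 (τ s f)), f, rfl⟩
    have hy : symmDiff x.1.2 y.1.2 = τ s f := symmDiff_symmDiff_cancel_left _ _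
    exact ⟨y, (h₃ x y s f hs rfl hy.symm).trans hy⟩

/-- Finite model property of the static language, with a bound. -/
theorem StatFormula.exists_finite_model {A V S F : Type*} (val : S → A → Prop) (out : S → F → V)
    (ψ : StatFormula A V) (s : S) (f : F) (hψ : ψ.Holds val (fun s f x => out s f = x) s f)
    {k N : ℕ} (hk : ψ.subs.length ≤ k) (hN : 2 ^ 2 ^ k * 2 ^ k ≤ N) :
    ∃ (val' : Fin N → A → Prop) (out' : Fin N → Fin N → V) (i j : Fin N),
      ψ.Holds val' (fun s f x => out' s f = x) i j := by
  let T (s : S) (f : F) : Set (Fin k) :=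
    {n | ∃ χ, ψ.subs[n.1]? = some χ ∧ χ.Holds val (fun s f x => out s f = x) s f}
  have hT {s f s' f'} (h : T s f = T s' f') {χ} (hχ : χ ∈ ψ.subs) :
      χ.Holds val (fun s f x => out s f = x) s f ↔
        χ.Holds val (fun s f x => out s f = x) s' f' := by
    obtain ⟨n, hn, rfl⟩ := List.getElem_of_mem hχ
    have := Set.ext_iff.1 h ⟨n, hn.trans_le hk⟩
    simpa [T, hn] using this
  obtain ⟨X, Y, h, hX, ⟨y, hy⟩, h₁, h₂, h₃, h₄⟩ := exists_regular_sampling T s f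
  have card (X : Set (Set (Set (Fin k)) × Set (Fin k))) : Nat.card X ≤ N := by
    refine (Nat.card_le_card_of_injective _ Subtype.val_injective).trans (le_trans ?_ hN)
    simp [Nat.card_eq_fintype_card]
  have : Nonempty X := hX.to_subtype
  have : Nonempty Y := ⟨y⟩
  obtain ⟨a, ha⟩ := exists_surjective_fin (card X)
  obtain ⟨b, hb⟩ := exists_surjective_fin (card Y)
  -- The sampled instance `(h (a i) (b j)).1` varies with `j`, while atoms may depend on `i` only.
  -- Rows of the same kind share a type, hence agree on every atom of `ψ`.
  let val' (i : Fin N) (p : A) : Prop := ∃ s, Set.range (T s) = (a i).1.1 ∧ val s p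
  let out' (i j : Fin N) : V := out (h (a i) (b j)).1 (h (a i) (b j)).2
  have key (χ : StatFormula A V) (hχ : χ ∈ ψ.subs) (i j : Fin N) :
      χ.Holds val' (fun s f x => out' s f = x) i j ↔
        χ.Holds val (fun s f x => out s f = x) (h (a i) (b j)).1 (h (a i) (b j)).2 := by
    induction χ generalizing i j with
    | top => rfl
    | atom p =>
      constructor
      · rintro ⟨s, hs, hp⟩
        obtain ⟨f', hf'⟩ : T s (h (a i) (b j)).2 ∈ Set.range (T (h (a i) (b j)).1) := by
          rw [h₁, ← hs]
          exact ⟨_, rfl⟩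
        exact (hT hf' hχ).2 hp
      · exact fun hp => ⟨_, h₁ _ _, hp⟩
    | dec x => rfl
    | neg χ ih =>
      simp only [Holds, ih (subs_subset hχ (List.mem_cons_of_mem _ χ.self_mem_subs))]
    | and χ₁ χ₂ ih₁ ih₂ =>
      simp only [Holds,
        ih₁ (subs_subset hχ (List.mem_cons_of_mem _ (List.mem_append_left _ χ₁.self_mem_subs))),
        ih₂ (subs_subset hχ (List.mem_cons_of_mem _ (List.mem_append_right _ χ₂.self_mem_subs)))]
    | boxI χ ih =>
      have hχ' := subs_subset hχ (List.mem_cons_of_mem _ χ.self_mem_subs)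
      simp only [Holds, ih hχ']
      constructor
      · intro H s
        -- Every type on the original column is met on the sampled one; the converse below holds
        -- because the sampled points of a column all lie on columns of one kind.
        obtain ⟨x, hx⟩ := h₃ s (b j) (h (a i) (b j)).2 (h₂ _ _)
        obtain ⟨i', rfl⟩ := ha x
        exact (hT hx hχ').1 (H i')
      · intro H i'
        obtain ⟨s, hs⟩ : T (h (a i') (b j)).1 (h (a i') (b j)).2 ∈
            Set.range (fun s => T s (h (a i) (b j)).2) := by
          rw [h₂, ← h₂ (a i') (b j)]
          exact ⟨_, rfl⟩
        exact (hT hs hχ').1 (H s)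
    | boxF χ ih =>
      have hχ' := subs_subset hχ (List.mem_cons_of_mem _ χ.self_mem_subs)
      simp only [Holds, ih hχ']
      constructor
      · intro H f
        obtain ⟨y, hy⟩ := h₄ (a i) (h (a i) (b j)).1 f (h₁ _ _)
        obtain ⟨j', rfl⟩ := hb y
        exact (hT hy hχ').1 (H j')
      · intro H j'
        obtain ⟨f, hf⟩ : T (h (a i) (b j')).1 (h (a i) (b j')).2 ∈
            Set.range (T (h (a i) (b j)).1) := by
          rw [h₁, ← h₁ (a i) (b j')]
          exact ⟨_, rfl⟩
        exact (hT hf hχ').1 (H f)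
  obtain ⟨x, hx⟩ := h₃ s y f hy
  obtain ⟨i, rfl⟩ := ha x
  obtain ⟨j, rfl⟩ := hb y
  exact ⟨val', out', i, j, (key ψ ψ.self_mem_subs i j).2 ((hT hx ψ.self_mem_subs).2 hψ)⟩

/-! ### Passage between multi-classifier models and finite frames. -/

theorem DynFormula.relHolds_univ_iff {A V S F : Type*} (val : S → A → Prop)
    (out : S → F → V → Prop) (φ : DynFormula A V) (s : S) (f : F) :
    φ.RelHolds val out Set.univ s f ↔ (φ.toStat .top).Holds val out s f := by
  rw [← relHolds_iff_toStat]
  simp [StatFormula.Holds]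

/-- A satisfiable formula holds in a frame of bounded size. -/
theorem DynFormula.Satisfiable.exists_finite_frame {A V : Type*} {φ : DynFormula A V}
    (h : φ.Satisfiable) :
    ∃ (val : Fin (dynBound φ.word.length) → A → Prop)
      (out : Fin (dynBound φ.word.length) → Fin (dynBound φ.word.length) → V) (i j : Fin _),
      φ.RelHolds val (fun s f x => out s f = x) Set.univ i j := by
  obtain ⟨⟨S, Φ⟩, s, f, hf, h⟩ := h
  rw [holds_iff_relHolds] at h
  have h' : φ.RelHolds (fun (s : S) p => p ∈ s.1) (fun s (f : Φ) x => f.1 s = x) Set.univ s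
      ⟨f, hf⟩ :=
    (relHolds_comap φ (val' := fun (s : S) p => p ∈ s.1) (out' := fun s (f : S → V) x => f s = x)
      (a := id) (g := fun f : Φ => f.1)
      Function.surjective_id (fun _ _ _ => Iff.rfl) (fun _ _ _ => Iff.rfl) (P := Set.univ) (P' := Φ)
      (by simp) (by simp) s ⟨f, hf⟩).2 h
  rw [relHolds_univ_iff] at h'
  obtain ⟨val, out, i, j, H⟩ := StatFormula.exists_finite_model _ (fun s (f : Φ) => f.1 s)
    _ _ _ h' (k := 8 ^ φ.word.length) (N := dynBound φ.word.length)
    (by simpa [StatFormula.subs] using length_subs_toStat_le φ (.top)) le_rfl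
  refine ⟨val, out, i, j, ?_⟩
  rw [relHolds_univ_iff]
  exact H

/-- With infinitely many atoms, every finite frame comes from a multi-classifier model. -/
theorem DynFormula.satisfiable_of_relHolds {A V S F : Type*} [Infinite A] [Finite S]
    {φ : DynFormula A V} {val : S → A → Prop} {out : S → F → V} {s : S} {f : F}
    (h : φ.RelHolds val (fun s f x => out s f = x) Set.univ s f) : φ.Satisfiable := by
  have hfin : {p : A | .inl p ∈ φ.word}.Finite :=
    (List.finite_toSet φ.word).preimage Sum.inl_injective.injOn
  have : Infinite ({p : A | .inl p ∈ φ.word}ᶜ : Set A) := hfin.infinite_compl.to_subtype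
  let c : S → A := fun s => (Infinite.natEmbedding ({p : A | .inl p ∈ φ.word}ᶜ : Set A)
    (Finite.equivFin S s)).1
  have hc (s) : .inl (c s) ∉ φ.word :=
    (Infinite.natEmbedding ({p : A | .inl p ∈ φ.word}ᶜ : Set A) (Finite.equivFin S s)).2
  have hinj : Function.Injective c := Subtype.val_injective.comp
    ((Infinite.natEmbedding _).injective.comp (Fin.val_injective.comp (Equiv.injective _)))
  -- Each instance keeps its atoms from `φ` and gains a private atom foreign to `φ`. This makes the
  -- instances distinct sets without affecting `φ`.
  let e : S → Set A := fun s => {p | (.inl p ∈ φ.word ∧ val s p) ∨ p = c s}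
  have he : Function.Injective e := by
    intro s t hst
    have : c s ∈ e t := hst ▸ Or.inr rfl
    rcases this with h | h
    · exact (hc s h.1).elim
    · exact hinj h
  let a : S ≃ Set.range e := Equiv.ofInjective e he
  let g : F → (Set.range e → V) := fun f s => out (a.symm s) f
  refine ⟨⟨Set.range e, Set.range g⟩, a s, g f, ⟨f, rfl⟩, ?_⟩
  rw [holds_iff_relHolds]
  refine (relHolds_comap φ (a := a) (g := g) a.surjective ?_ ?_ (P := Set.univ) ?_ ?_ s f).1 h
  · intro s p hp
    have : p ≠ c s := by rintro rfl; exact hc s hp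
    simp [a, e, hp, this]
  · intro s f x
    simp [g]
  · simp
  · exact subset_rfl

/-! ### Primitive recursive evaluation of formulas. -/

theorem DynFormula.primrec_word {A V : Type*} [Primcodable A] [Primcodable V] :
    Primrec (DynFormula.word : DynFormula A V → List (DynSymbol A V)) :=
  Primrec.encode_iff.1 Primrec.encode

/-- Compositional evaluation of formulas; `d` fills the places of missing arguments. -/
def DynFormula.fold {A V σ : Type*} (d : σ) (g : DynSymbol A V → σ → σ → σ) :
    DynFormula A V → σ
  | .atom p => g (.inl p) d d
  | .dec x => g (.inr (.inl x)) d d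
  | .neg φ => g (.inr (.inr 0)) (φ.fold d g) d
  | .and φ ψ => g (.inr (.inr 1)) (φ.fold d g) (ψ.fold d g)
  | .boxI φ => g (.inr (.inr 2)) (φ.fold d g) d
  | .boxF φ => g (.inr (.inr 3)) (φ.fold d g) d
  | .upd φ ψ => g (.inr (.inr 4)) (φ.fold d g) (ψ.fold d g)

/-- Effect of a symbol on a stack of values. -/
def DynSymbol.stackStep {A V σ : Type*} (d : σ) (g : DynSymbol A V → σ → σ → σ)
    (c : DynSymbol A V) (l : List σ) : List σ :=
  g c (if 0 < c.arity then l.getD 0 d else d) (if 1 < c.arity then l.getD 1 d else d) ::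
    l.drop c.arity

theorem DynFormula.foldr_stackStep {A V σ : Type*} (d : σ) (g : DynSymbol A V → σ → σ → σ)
    (φ : DynFormula A V) (l : List σ) :
    φ.word.foldr (DynSymbol.stackStep d g) l = φ.fold d g :: l := by
  induction φ generalizing l with
  | atom p => simp [word, fold, DynSymbol.stackStep, DynSymbol.arity]
  | dec x => simp [word, fold, DynSymbol.stackStep, DynSymbol.arity]
  | neg φ ih => simp [word, fold, ih, DynSymbol.stackStep, DynSymbol.arity]
  | and φ ψ ih₁ ih₂ => simp [word, fold, ih₁, ih₂, DynSymbol.stackStep, DynSymbol.arity]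
  | boxI φ ih => simp [word, fold, ih, DynSymbol.stackStep, DynSymbol.arity]
  | boxF φ ih => simp [word, fold, ih, DynSymbol.stackStep, DynSymbol.arity]
  | upd φ ψ ih₁ ih₂ => simp [word, fold, ih₁, ih₂, DynSymbol.stackStep, DynSymbol.arity]

/-- Reading the prefix string from right to left with a stack turns structural recursion into a fold
over a list. The parameter `u φ` lets the operations depend on the whole formula, as the search
space for tables does. -/
theorem DynFormula.primrec_fold {A V α σ : Type*} [Primcodable A] [Primcodable V]
    [Primcodable α] [Primcodable σ] (d : σ) {g : α → DynSymbol A V → σ → σ → σ}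
    (hg : Primrec fun q : α × DynSymbol A V × σ × σ => g q.1 q.2.1 q.2.2.1 q.2.2.2)
    {u : DynFormula A V → α} (hu : Primrec u) :
    Primrec fun φ : DynFormula A V => φ.fold d (g (u φ)) := by
  have hc : Primrec fun q : DynFormula A V × DynSymbol A V × List σ => q.2.1 :=
    Primrec.fst.comp Primrec.snd
  have hl : Primrec fun q : DynFormula A V × DynSymbol A V × List σ => q.2.2 :=
    Primrec.snd.comp Primrec.snd
  have ha := DynSymbol.primrec_arity.comp hc
  have harg (n : ℕ) : Primrec fun q : DynFormula A V × DynSymbol A V × List σ =>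
      if n < q.2.1.arity then q.2.2.getD n d else d :=
    Primrec.ite (Primrec.nat_lt.comp (Primrec.const n) ha)
      ((Primrec.list_getD d).comp hl (Primrec.const n)) (Primrec.const d)
  have hstep : Primrec₂ fun (φ : DynFormula A V) (q : DynSymbol A V × List σ) =>
      DynSymbol.stackStep d (g (u φ)) q.1 q.2 :=
    Primrec.list_cons.comp
      (hg.comp ((hu.comp Primrec.fst).pair (hc.pair ((harg 0).pair (harg 1)))))
      (Primrec.list_drop.comp ha hl)
  refine ((Primrec.list_getD d).comp
    (Primrec.list_foldr primrec_word (Primrec.const []) hstep) (Primrec.const 0)).of_eq ?_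
  intro φ
  simp [foldr_stackStep]

/-! ### Finitely many atoms. -/

instance {A V : Type*} [Finite A] [Finite V] : Finite (MCM A V) :=
  Finite.of_injective (fun Γ : MCM A V => (⟨Γ.S, Γ.Φ⟩ : Σ S : Set (Set A), Set (S → V))) <| by
    rintro ⟨S, Φ⟩ ⟨S', Φ'⟩ h
    cases h
    rfl

/-- Pointed pairs of an instance and a classifier of a multi-classifier model. -/
abbrev MCM.Point (A V : Type*) := Σ Γ : MCM A V, Γ.S × (Γ.S → V)

/-- The connectives as operations on sets of pointed models. -/
def MCM.Point.op {A V : Type*} : DynSymbol A V → Set (MCM.Point A V) → Set (MCM.Point A V) →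
    Set (MCM.Point A V)
  | .inl p, _, _ => {q | p ∈ q.2.1.1}
  | .inr (.inl x), _, _ => {q | q.2.2 q.2.1 = x}
  | .inr (.inr 0), X, _ => Xᶜ
  | .inr (.inr 1), X, Y => X ∩ Y
  | .inr (.inr 2), X, _ => {q | ∀ s' : q.1.S, ⟨q.1, s', q.2.2⟩ ∈ X}
  | .inr (.inr 3), X, _ => {q | ∀ f' ∈ q.1.Φ, ⟨q.1, q.2.1, f'⟩ ∈ X}
  | .inr (.inr 4), X, Y => {q | (∀ s' : q.1.S, ⟨q.1, s', q.2.2⟩ ∈ X) →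
      ⟨q.1.restrict fun s f => ⟨q.1, s, f⟩ ∈ X, q.2⟩ ∈ Y}

theorem DynFormula.mem_fold_op {A V : Type*} (φ : DynFormula A V) (Γ : MCM A V) (s : Γ.S)
    (f : Γ.S → V) : ⟨Γ, s, f⟩ ∈ φ.fold ∅ MCM.Point.op ↔ φ.Holds Γ s f := by
  induction φ generalizing Γ with
  | atom p => rfl
  | dec x => rfl
  | neg φ ih => exact not_congr (ih Γ s f)
  | and φ ψ ih₁ ih₂ => exact and_congr (ih₁ Γ s f) (ih₂ Γ s f)
  | boxI φ ih => exact forall_congr' fun s' => ih Γ s' f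
  | boxF φ ih => exact forall₂_congr fun f' _ => ih Γ s f'
  | upd φ ψ ih₁ ih₂ =>
    have : (fun s f => ⟨Γ, s, f⟩ ∈ φ.fold ∅ MCM.Point.op) = φ.Holds Γ :=
      funext₂ fun s f => propext (ih₁ Γ s f)
    have h := ih₂ (Γ.restrict fun s f => ⟨Γ, s, f⟩ ∈ φ.fold ∅ MCM.Point.op) s f
    rw [this] at h
    refine (imp_congr (forall_congr' fun s' => ih₁ Γ s' f) ?_ :)
    rw [← h, this]
    rfl

/-- The sets of pointed models form a finite type, on which every operation is primitive recursive,
so the denotation of a formula can be computed. -/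
theorem DynFormula.computablePred_satisfiable_of_finite {A V : Type*} [Primcodable A]
    [Primcodable V] [Finite A] [Finite V] :
    ComputablePred fun φ : DynFormula A V => φ.Satisfiable := by
  classical
  let e := Finite.equivFin (Set (MCM.Point A V))
  let _ : Primcodable (Set (MCM.Point A V)) := Primcodable.ofEquiv _ e
  have h : Primrec fun φ : DynFormula A V => φ.fold ∅ MCM.Point.op :=
    primrec_fold (α := Unit) (g := fun _ => MCM.Point.op) (u := fun _ => ()) ∅
      (Primrec.dom_finite _) (Primrec.const ())
  have hp : PrimrecPred fun X : Set (MCM.Point A V) => ∃ q ∈ X, q.2.2 ∈ q.1.Φ :=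
    Primrec.primrecPred (Primrec.dom_finite _)
  refine (hp.comp h).computablePred.of_eq fun φ => ?_
  constructor
  · rintro ⟨⟨Γ, s, f⟩, h, hf⟩
    exact ⟨Γ, s, f, hf, (φ.mem_fold_op Γ s f).1 h⟩
  · rintro ⟨Γ, s, f, hf, h⟩
    exact ⟨⟨Γ, s, f⟩, (φ.mem_fold_op Γ s f).2 h, hf⟩

/-! ### Primitive recursive operations on lists. -/

theorem PrimrecRel.list_mem {α : Type*} [Primcodable α] :
    PrimrecRel fun (a : α) (l : List α) => a ∈ l := by
  refine ((PrimrecRel.exists_mem_list (α := α) (β := α) (R := fun a b => a = b) Primrec.eq).comp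
    Primrec.snd Primrec.fst).of_eq ?_
  simp

theorem Primrec.list_product {α β : Type*} [Primcodable α] [Primcodable β] :
    Primrec₂ fun (l : List α) (m : List β) => l ×ˢ m :=
  Primrec.list_flatMap Primrec.fst
    (Primrec.list_map (Primrec.snd.comp Primrec.fst)
      (Primrec.pair (Primrec.snd.comp Primrec.fst) Primrec.snd).to₂).to₂

/-- The lists of length at most `n` with entries in `l`. -/
def List.listsUpTo {α : Type*} (l : List α) (n : ℕ) : List (List α) :=
  n.rec [[]] fun _ L => [] :: l.flatMap fun a => L.map fun m => a :: m

theorem List.mem_listsUpTo {α : Type*} {l : List α} {n : ℕ} {m : List α} :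
    m ∈ l.listsUpTo n ↔ m.length ≤ n ∧ m ⊆ l := by
  induction n generalizing m with
  | zero => cases m <;> simp [listsUpTo]
  | succ n ih =>
    have h : l.listsUpTo (n + 1) =
      [] :: l.flatMap fun a => (l.listsUpTo n).map fun m => a :: m := rfl
    cases m with
    | nil => simp [h]
    | cons a m =>
      simp [h, ih]
      tauto

theorem Primrec.list_listsUpTo {α : Type*} [Primcodable α] :
    Primrec₂ (List.listsUpTo : List α → ℕ → List (List α)) := by
  have h : Primrec₂ fun (l : List α) (q : ℕ × List (List α)) =>
      [] :: l.flatMap fun a => q.2.map fun m => a :: m := by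
    refine Primrec.list_cons.comp (Primrec.const []) ?_
    refine Primrec.list_flatMap Primrec.fst ?_
    refine Primrec.list_map (Primrec.snd.comp (Primrec.snd.comp Primrec.fst)) ?_
    exact Primrec.list_cons.comp (Primrec.snd.comp Primrec.fst) Primrec.snd
  exact Primrec.nat_rec (Primrec.const [[]]) h

/-! ### Evaluation of formulas on finite tables. -/

/-- A finite list of rows (sets of atoms), a list of columns (classifiers), the position of a row,
and a column. -/
abbrev TablePoint (A V : Type*) := List (List A) × List (List V) × ℕ × List V

/-- The columns that satisfy everywhere a property given by the list of its points. -/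
noncomputable def TablePoint.restrict {A V : Type*} (X : List (TablePoint A V)) (R : List (List A))
    (C : List (List V)) : List (List V) :=
  open Classical in C.filter fun f => ∀ i ∈ List.range R.length, (R, C, i, f) ∈ X

/-- Truth at a point of a formula with the given main symbol, where `X` and `Y` are the lists of
points at which the arguments are true. -/
def TablePoint.Sat {A V : Type*} (c : DynSymbol A V) (X Y : List (TablePoint A V))
    (q : TablePoint A V) : Prop :=
  c ∈ (q.1.getD q.2.2.1 []).map Sum.inl ∨
  (q.2.2.2[q.2.2.1]?).map (fun x => Sum.inr (Sum.inl x)) = some c ∨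
  (c = .inr (.inr 0) ∧ q ∉ X) ∨
  (c = .inr (.inr 1) ∧ q ∈ X ∧ q ∈ Y) ∨
  (c = .inr (.inr 2) ∧ ∀ i ∈ List.range q.1.length, (q.1, q.2.1, i, q.2.2.2) ∈ X) ∨
  (c = .inr (.inr 3) ∧ ∀ f ∈ q.2.1, (q.1, q.2.1, q.2.2.1, f) ∈ X) ∨
  (c = .inr (.inr 4) ∧ ((¬ ∀ i ∈ List.range q.1.length, (q.1, q.2.1, i, q.2.2.2) ∈ X) ∨
    (q.1, TablePoint.restrict X q.1 q.2.1, q.2.2) ∈ Y))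

/-- The points of `U` at which a formula is true. -/
noncomputable def TablePoint.op {A V : Type*} (U : List (TablePoint A V)) (c : DynSymbol A V)
    (X Y : List (TablePoint A V)) : List (TablePoint A V) :=
  open Classical in U.filter fun q => TablePoint.Sat c X Y q

theorem TablePoint.mem_op {A V : Type*} {U X Y : List (TablePoint A V)} {c : DynSymbol A V}
    {q : TablePoint A V} : q ∈ TablePoint.op U c X Y ↔ q ∈ U ∧ TablePoint.Sat c X Y q := by
  classical
  simp [TablePoint.op]

theorem TablePoint.mem_restrict {A V : Type*} {X : List (TablePoint A V)} {R : List (List A)}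
    {C : List (List V)} {f : List V} :
    f ∈ TablePoint.restrict X R C ↔
      f ∈ C ∧ ∀ i ∈ List.range R.length, (R, C, i, f) ∈ X := by
  classical
  simp [TablePoint.restrict]

theorem TablePoint.primrec_forall_rows {A V : Type*} [Primcodable A] [Primcodable V] :
    PrimrecRel fun (f : List V) (q : List (TablePoint A V) × List (List A) × List (List V)) =>
      ∀ i ∈ List.range q.2.1.length, (q.2.1, q.2.2, i, f) ∈ q.1 := by
  have h : PrimrecRel fun (i : ℕ)
      (p : List V × List (TablePoint A V) × List (List A) × List (List V)) =>
      (p.2.2.1, p.2.2.2, i, p.1) ∈ p.2.1 := by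
    have hp := Primrec.snd (α := ℕ)
      (β := List V × List (TablePoint A V) × List (List A) × List (List V))
    have hp₂ := Primrec.snd.comp hp
    have hp₃ := Primrec.snd.comp hp₂
    exact PrimrecRel.list_mem.comp
      ((Primrec.fst.comp hp₃).pair ((Primrec.snd.comp hp₃).pair
        (Primrec.fst.pair (Primrec.fst.comp hp)))) (Primrec.fst.comp hp₂)
  exact h.forall_mem_list.comp (Primrec.list_range.comp (Primrec.list_length.comp
    (Primrec.fst.comp (Primrec.snd.comp Primrec.snd)))) Primrec.id

theorem TablePoint.primrec_restrict {A V : Type*} [Primcodable A] [Primcodable V] :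
    Primrec fun q : List (TablePoint A V) × List (List A) × List (List V) =>
      TablePoint.restrict q.1 q.2.1 q.2.2 := by
  classical
  refine (TablePoint.primrec_forall_rows.listFilter.comp (Primrec.snd.comp Primrec.snd)
    Primrec.id).of_eq fun q => ?_
  rw [TablePoint.restrict]
  congr!

theorem TablePoint.primrec_sat {A V : Type*} [Primcodable A] [Primcodable V] :
    PrimrecRel fun (q : TablePoint A V)
      (p : DynSymbol A V × List (TablePoint A V) × List (TablePoint A V)) =>
      TablePoint.Sat p.1 p.2.1 p.2.2 q := by
  have hq := Primrec.fst (α := TablePoint A V)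
    (β := DynSymbol A V × List (TablePoint A V) × List (TablePoint A V))
  have hp := Primrec.snd (α := TablePoint A V)
    (β := DynSymbol A V × List (TablePoint A V) × List (TablePoint A V))
  have hc := Primrec.fst.comp hp
  have hX := Primrec.fst.comp (Primrec.snd.comp hp)
  have hY := Primrec.snd.comp (Primrec.snd.comp hp)
  have hR := Primrec.fst.comp hq
  have hC := Primrec.fst.comp (Primrec.snd.comp hq)
  have hif := Primrec.snd.comp (Primrec.snd.comp hq)
  have hi := Primrec.fst.comp hif
  have hf := Primrec.snd.comp hif
  have hsym (c : Fin 5) : PrimrecPred fun z : TablePoint A V ×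
      DynSymbol A V × List (TablePoint A V) × List (TablePoint A V) =>
      z.2.1 = .inr (.inr c) := Primrec.eq.comp hc (Primrec.const _)
  have hrows := TablePoint.primrec_forall_rows.comp hf (hX.pair (hR.pair hC))
  have hcols : PrimrecRel fun (f : List V) (z : TablePoint A V ×
      DynSymbol A V × List (TablePoint A V) × List (TablePoint A V)) =>
      (z.1.1, z.1.2.1, z.1.2.2.1, f) ∈ z.2.2.1 :=
    PrimrecRel.list_mem.comp ((hR.comp Primrec.snd).pair ((hC.comp Primrec.snd).pair
      ((hi.comp Primrec.snd).pair Primrec.fst))) (hX.comp Primrec.snd)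
  refine PrimrecPred.or ?_ <| PrimrecPred.or ?_ <| PrimrecPred.or ?_ <| PrimrecPred.or ?_ <|
    PrimrecPred.or ?_ <| PrimrecPred.or ?_ ?_
  · exact PrimrecRel.list_mem.comp hc (Primrec.list_map ((Primrec.list_getD []).comp hR hi)
      (Primrec.sumInl.comp Primrec.snd).to₂)
  · exact Primrec.eq.comp (Primrec.option_map (Primrec.list_getElem?.comp hf hi)
      (Primrec.sumInr.comp (Primrec.sumInl.comp Primrec.snd)).to₂) (Primrec.option_some.comp hc)
  · exact (hsym 0).and (PrimrecRel.list_mem.comp hq hX).not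
  · exact (hsym 1).and ((PrimrecRel.list_mem.comp hq hX).and (PrimrecRel.list_mem.comp hq hY))
  · exact (hsym 2).and hrows
  · exact (hsym 3).and (hcols.forall_mem_list.comp hC Primrec.id)
  · exact (hsym 4).and (hrows.not.or (PrimrecRel.list_mem.comp (hR.pair
      ((TablePoint.primrec_restrict.comp (hX.pair (hR.pair hC))).pair hif)) hY))

theorem TablePoint.primrec_op {A V : Type*} [Primcodable A] [Primcodable V] :
    Primrec fun z : List (TablePoint A V) × DynSymbol A V × List (TablePoint A V) ×
      List (TablePoint A V) => TablePoint.op z.1 z.2.1 z.2.2.1 z.2.2.2 := by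
  classical
  refine (TablePoint.primrec_sat.listFilter.comp Primrec.fst Primrec.snd).of_eq fun z => ?_
  rw [TablePoint.op]

/-- Correctness of the evaluation of formulas on lists of points. -/
theorem DynFormula.mem_fold_tableOp {A V : Type*} {U : List (TablePoint A V)}
    {R : List (List A)}
    (hI : ∀ {C i f}, (R, C, i, f) ∈ U → ∀ {j}, j < R.length → (R, C, j, f) ∈ U)
    (hF : ∀ {C i f}, (R, C, i, f) ∈ U → ∀ {g}, g ∈ C → (R, C, i, g) ∈ U)
    (hC : ∀ {C i f}, (R, C, i, f) ∈ U → ∀ {D}, D.Sublist C → (R, D, i, f) ∈ U)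
    (φ : DynFormula A V) {C : List (List V)} {i : Fin R.length} {f : List V}
    (hU : (R, C, i.1, f) ∈ U) :
    (R, C, i.1, f) ∈ φ.fold [] (TablePoint.op U) ↔
      φ.RelHolds (fun (i : Fin R.length) p => p ∈ R[i])
        (fun i (f : List V) x => f[i.1]? = some x) {g | g ∈ C} i f := by
  induction φ generalizing C i f with
  | atom p => simp [fold, TablePoint.mem_op, TablePoint.Sat, RelHolds, hU]
  | dec x => simp [fold, TablePoint.mem_op, TablePoint.Sat, RelHolds, hU]
  | neg φ ih => simp [fold, TablePoint.mem_op, TablePoint.Sat, RelHolds, hU, ih hU]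
  | and φ ψ ih₁ ih₂ =>
    simp [fold, TablePoint.mem_op, TablePoint.Sat, RelHolds, hU, ih₁ hU, ih₂ hU]
  | boxI φ ih =>
    simp [fold, TablePoint.mem_op, TablePoint.Sat, RelHolds, hU, Fin.forall_iff]
    exact forall₂_congr fun j hj => ih (i := ⟨j, hj⟩) (hI hU hj)
  | boxF φ ih =>
    simp [fold, TablePoint.mem_op, TablePoint.Sat, RelHolds, hU]
    exact forall₂_congr fun g hg => ih (hF hU hg)
  | upd φ ψ ih₁ ih₂ =>
    have h {f} (hU : (R, C, i.1, f) ∈ U) :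
        (∀ j ∈ List.range R.length, (R, C, j, f) ∈ φ.fold [] (TablePoint.op U)) ↔
        ∀ j : Fin R.length, φ.RelHolds (fun (i : Fin R.length) p => p ∈ R[i])
          (fun i (f : List V) x => f[i.1]? = some x) {g | g ∈ C} j f := by
      simp only [Fin.forall_iff, List.mem_range]
      exact forall₂_congr fun j hj => ih₁ (i := ⟨j, hj⟩) (hI hU hj)
    -- An update only deletes columns from the list, so `hC` keeps the updated point inside `U`.
    have hD : (TablePoint.restrict (φ.fold [] (TablePoint.op U)) R C).Sublist C := List.filter_sublist
    have hr : {g | g ∈ TablePoint.restrict (φ.fold [] (TablePoint.op U)) R C} =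
        {g | g ∈ {g | g ∈ C} ∧ ∀ j : Fin R.length,
          φ.RelHolds (fun (i : Fin R.length) p => p ∈ R[i])
            (fun i (f : List V) x => f[i.1]? = some x) {g | g ∈ C} j g} := by
      ext g
      simp only [TablePoint.mem_restrict, Set.mem_ofPred_eq]
      exact and_congr_right fun hg => h (hF hU hg)
    have h₂ := ih₂ (hC hU hD)
    rw [hr] at h₂
    simp only [RelHolds, ← h₂, ← h hU]
    simp only [fold, TablePoint.mem_op, hU, true_and, imp_iff_not_or]
    simp [TablePoint.Sat]

/-! ### Infinitely many atoms: search through tables of bounded size. -/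

/-- The points among which a formula is evaluated. -/
def DynFormula.tablePoints {A V : Type*} (vs : List V) (φ : DynFormula A V) :
    List (TablePoint A V) :=
  let L := φ.word.filterMap Sum.getLeft?
  let N := dynBound φ.word.length
  (L.listsUpTo L.length).listsUpTo N ×ˢ (vs.listsUpTo N).listsUpTo N ×ˢ List.range N ×ˢ
    vs.listsUpTo N

theorem primrec_dynBound : Primrec dynBound := by
  have hpow (b : ℕ) : Primrec fun n : ℕ => b ^ n := by
    refine (Primrec.nat_rec₁ 1 (f := fun _ r => r * b)
      (Primrec.nat_mul.comp Primrec.snd (Primrec.const b)).to₂).of_eq fun n => ?_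
    induction n with
    | zero => rfl
    | succ n ih => simp [pow_succ, ← ih]
  exact Primrec.nat_mul.comp ((hpow 2).comp ((hpow 2).comp (hpow 8))) ((hpow 2).comp (hpow 8))

theorem DynFormula.primrec_tablePoints {A V : Type*} [Primcodable A] [Primcodable V]
    (vs : List V) :
    Primrec (DynFormula.tablePoints vs : DynFormula A V → List (TablePoint A V)) := by
  have hget : Primrec (Sum.getLeft? : DynSymbol A V → Option A) :=
    (Primrec.sumCasesOn (f := fun c : DynSymbol A V => c) (g := fun _ p => some p)
      (h := fun _ _ => none) Primrec.id (Primrec.option_some.comp Primrec.snd).to₂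
      (Primrec.const none).to₂).of_eq (by rintro (p | c) <;> rfl)
  have hL : Primrec fun φ : DynFormula A V => φ.word.filterMap Sum.getLeft? :=
    Primrec.listFilterMap primrec_word (hget.comp Primrec.snd).to₂
  have hN : Primrec fun φ : DynFormula A V => dynBound φ.word.length :=
    primrec_dynBound.comp (Primrec.list_length.comp primrec_word)
  have hf := Primrec.list_listsUpTo.comp (Primrec.const vs) hN
  exact Primrec.list_product.comp (Primrec.list_listsUpTo.comp (Primrec.list_listsUpTo.comp hL
    (Primrec.list_length.comp hL)) hN) <| Primrec.list_product.comp
    (Primrec.list_listsUpTo.comp hf hN) <| Primrec.list_product.comp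
    (Primrec.list_range.comp hN) hf

theorem DynFormula.mem_tablePoints {A V : Type*} {vs : List V} {φ : DynFormula A V}
    {R : List (List A)} {C : List (List V)} {i : ℕ} {f : List V} :
    (R, C, i, f) ∈ φ.tablePoints vs ↔
      (R.length ≤ dynBound φ.word.length ∧ R ⊆
        (φ.word.filterMap Sum.getLeft?).listsUpTo (φ.word.filterMap Sum.getLeft?).length) ∧
      (C.length ≤ dynBound φ.word.length ∧ C ⊆ vs.listsUpTo (dynBound φ.word.length)) ∧
      i < dynBound φ.word.length ∧ f ∈ vs.listsUpTo (dynBound φ.word.length) := by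
  simp only [tablePoints, List.mem_product, List.mem_range]
  rw [List.mem_listsUpTo (m := R), List.mem_listsUpTo (m := C)]

/-- A formula is satisfiable if and only if it is true at a point with total columns. -/
theorem DynFormula.satisfiable_iff_table {A V : Type*} [Infinite A] {vs : List V}
    (hvs : ∀ x, x ∈ vs) (φ : DynFormula A V) :
    (∃ q ∈ φ.fold [] (TablePoint.op (φ.tablePoints vs)), q.2.2.2 ∈ q.2.1 ∧ q.2.2.1 < q.1.length ∧
      ∀ f ∈ q.2.1, f.length = q.1.length) ↔ φ.Satisfiable := by
  classical
  have hop (q) (h : q ∈ φ.fold [] (TablePoint.op (φ.tablePoints vs))) : q ∈ φ.tablePoints vs := by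
    cases φ <;> exact (TablePoint.mem_op.1 h).1
  -- Points outside the list count as false, so it has to be closed under change of row, change of
  -- column and deletion of columns. Bounding lengths from above instead of fixing them gives the
  -- last closure.
  have hmem {R : List (List A)} {C : List (List V)} {i : Fin R.length} {f : List V}
      (hU : (R, C, i.1, f) ∈ φ.tablePoints vs) :=
    mem_fold_tableOp (U := φ.tablePoints vs) (R := R)
      (by
        intro C i f h j hj
        rw [mem_tablePoints] at h ⊢
        exact ⟨h.1, h.2.1, hj.trans_le h.1.1, h.2.2.2⟩)
      (by
        intro C i f h g hg
        rw [mem_tablePoints] at h ⊢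
        exact ⟨h.1, h.2.1, h.2.2.1, h.2.1.2 hg⟩)
      (by
        intro C i f h D hD
        rw [mem_tablePoints] at h ⊢
        exact ⟨h.1, ⟨hD.length_le.trans h.2.1.1, fun _ hx => h.2.1.2 (hD.subset hx)⟩, h.2.2⟩)
      φ hU
  constructor
  · rintro ⟨⟨R, C, i, f⟩, h, hf, hi, hlen⟩
    have h' := (hmem (i := ⟨i, hi⟩) (hop _ h)).1 h
    -- Columns may be partial in the evaluation; the length condition makes those of `C` genuine
    -- functions on the rows.
    refine satisfiable_of_relHolds (S := Fin R.length) (F := {g // g ∈ C})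
      (val := fun i p => p ∈ R[i]) (out := fun i g => g.1[i.1]'(by simp [hlen _ g.2]))
      (s := ⟨i, hi⟩) (f := ⟨f, hf⟩) ?_
    refine (relHolds_comap φ (a := id) (g := Subtype.val) Function.surjective_id
      (fun _ _ _ => Iff.rfl) ?_ (P := Set.univ) (P' := {g | g ∈ C}) (by simp) ?_ _ _).2 h'
    · intro i g x
      simp [hlen _ g.2]
    · intro g hg
      exact ⟨⟨g, hg⟩, rfl⟩
  · intro h
    obtain ⟨val, out, i, j, h⟩ := h.exists_finite_frame
    let L := φ.word.filterMap Sum.getLeft?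
    have hL {p} : p ∈ L ↔ .inl p ∈ φ.word := by simp [L, List.mem_filterMap]
    -- Rows are addressed by position, so instances with equal atoms remain different. Only atoms of
    -- `φ` are recorded, which keeps the rows within the search space.
    let R : List (List A) := List.ofFn fun i => L.filter fun p => val i p
    have hR : R.length = dynBound φ.word.length := List.length_ofFn
    let g : Fin (dynBound φ.word.length) → List V := fun j => List.ofFn fun i => out i j
    have hg (j) : g j ∈ vs.listsUpTo (dynBound φ.word.length) :=
      List.mem_listsUpTo.2 ⟨by simp [g], fun x _ => hvs x⟩
    let C : List (List V) := List.ofFn g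
    have hU : (R, C, i.1, g j) ∈ φ.tablePoints vs := by
      rw [mem_tablePoints]
      refine ⟨⟨hR.le, ?_⟩, ⟨by simp [C], ?_⟩, i.2, hg j⟩
      · intro r hr
        obtain ⟨i, rfl⟩ := List.mem_ofFn.1 hr
        exact List.mem_listsUpTo.2 ⟨List.length_filter_le _ _, fun _ h => List.mem_of_mem_filter h⟩
      · intro f hf
        obtain ⟨j, rfl⟩ := List.mem_ofFn.1 hf
        exact hg j
    refine ⟨(R, C, i.1, g j), ?_, ?_, ?_, ?_⟩
    · refine (hmem (i := i.cast hR.symm) hU).2 ?_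
      refine (relHolds_comap φ (a := Fin.cast hR.symm) (g := g) ?_ ?_ ?_ (P := Set.univ) ?_ ?_
        i j).1 h
      · exact (finCongr hR.symm).surjective
      · intro i p hp
        simp [R, hL, hp]
      · intro i j x
        simp [g]
      · simp [C]
      · intro f hf
        exact List.mem_ofFn.1 hf
    · exact List.mem_ofFn.2 ⟨j, rfl⟩
    · exact i.2.trans_eq hR.symm
    · intro f hf
      obtain ⟨j, rfl⟩ := List.mem_ofFn.1 hf
      simp [g, R]

theorem DynFormula.computablePred_satisfiable_of_infinite {A V : Type*} [Primcodable A]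
    [Primcodable V] [Infinite A] [Finite V] :
    ComputablePred fun φ : DynFormula A V => φ.Satisfiable := by
  obtain ⟨vs, hvs⟩ := Finite.exists_univ_list V
  have h : Primrec fun φ : DynFormula A V => φ.fold [] (TablePoint.op (φ.tablePoints vs)) :=
    primrec_fold [] TablePoint.primrec_op (primrec_tablePoints vs)
  have hlen : PrimrecRel fun (f : List V) (R : List (List A)) => f.length = R.length :=
    Primrec.eq.comp (Primrec.list_length.comp Primrec.fst) (Primrec.list_length.comp Primrec.snd)
  have hR := Primrec.fst (α := List (List A)) (β := List (List V) × ℕ × List V)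
  have hq := Primrec.snd (α := List (List A)) (β := List (List V) × ℕ × List V)
  have hC := Primrec.fst.comp hq
  have hif := Primrec.snd.comp hq
  have hp : PrimrecPred fun q : TablePoint A V => q.2.2.2 ∈ q.2.1 ∧ q.2.2.1 < q.1.length ∧
      ∀ f ∈ q.2.1, f.length = q.1.length :=
    (PrimrecRel.list_mem.comp (Primrec.snd.comp hif) hC).and <|
      (Primrec.nat_lt.comp (Primrec.fst.comp hif) (Primrec.list_length.comp hR)).and
        (hlen.forall_mem_list.comp hC hR)
  exact (hp.exists_mem_list.comp h).computablePred.of_eq (satisfiable_iff_table hvs.2)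

theorem mainTheorem12 {A V : Type*} [Primcodable A] [Primcodable V] [Finite V] :
    ComputablePred (fun φ : DynFormula A V => φ.Satisfiable) := by
  cases finite_or_infinite A
  · exact DynFormula.computablePred_satisfiable_of_finite
  · exact DynFormula.computablePred_satisfiable_of_infinite
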